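/- There exists a non-empty Tychonoff space $X$ such that $X$ is dense-in-itself (it has no isolated points), $X$ is countably compact (every countable open cover has a finite subcover), every countable subset $S$ of $X$ is scattered (every non-empty $T \subseteq S$ has a point isolated in $T$), and $B_1(X)$ is a Baire space (every countable intersection of dense open sets is dense). Here $B_1(X)$ denotes the set of all functions $f : X \to \mathbb{R}$ that are pointwise limits of sequences of continuous real-valued functions on $X$, endowed with the topology of pointwise convergence. -/

import Mathlib

open Filter Topology

/-- A real-valued function is Baire-one if it is the pointwise limit of a sequence of
continuous real-valued functions. -/
def IsBaireOne {X : Type*} [TopologicalSpace X] (f : X → ℝ) : Prop :=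
  ∃ u : ℕ → X → ℝ, (∀ n, Continuous (u n)) ∧ ∀ x, Tendsto (fun n => u n x) atTop (𝓝 (f x))

/-- The space `B₁(X)` of Baire-one functions on `X`. As a subtype of `X → ℝ` it carries the
subspace topology of the product topology, that is, the topology of pointwise convergence. -/
abbrev BaireOneSpace (X : Type*) [TopologicalSpace X] : Type _ :=
  {f : X → ℝ // IsBaireOne f}

/-- A subset `S` of a topological space is scattered if every nonempty subset `T` of `S` has a
point that is isolated in `T`. -/
def IsScatteredSet {X : Type*} [TopologicalSpace X] (S : Set X) : Prop :=
  ∀ T : Set X, T ⊆ S → T.Nonempty → ∃ x ∈ T, ∃ U : Set X, IsOpen U ∧ U ∩ T = {x}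

/-! The space lies in the Stone space of the product σ-algebra on `Set ℕ → Bool`. It consists of the
principal points and all points reached from them by iterated limits, along one fixed ultrafilter
`𝒰` on a countable set, of families separated by disjoint measurable sets. Closure under these
limits gives countable compactness. Taking `𝒰` to be a weak P-point (Kunen) keeps countable sets
thin: by `Level.notMem_closure`, a point of level α is not in the closure of countably many other
points none of which has a level below α.

Hence each point has a clopen neighbourhood in which all other points of a given countable set have
smaller rank. Well-foundedness of the rank makes countable sets scattered, and it lets any real
function on a countable set extend to a Baire-one function (`exists_isBaireOne_extension`).
Extension implies the Baire property, because a nested sequence of boxes constrains values at only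
countably many points. There are no isolated points because a measurable set in an uncountable power
depends on countably many coordinates. -/

/-! ### Baire-one extensions from countable sets and the Baire property. -/

/-- If every real function on a countable subset extends to a Baire-one function, then `B₁(X)` is a
Baire space. -/
theorem baireSpace_baireOneSpace_of_extend {X : Type*} [TopologicalSpace X]
    (hext : ∀ F : Set X, F.Countable → ∀ φ : X → ℝ, ∃ g : X → ℝ, IsBaireOne g ∧ ∀ x ∈ F, g x = φ x) :
    BaireSpace (BaireOneSpace X) := by
  classical
  refine ⟨fun O hO hd => ?_⟩
  -- a closed box is given by a finite set, a centre and a radius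
  let St := {s : Finset X × BaireOneSpace X × ℝ // 0 < s.2.2}
  have basic : ∀ (U : Set (BaireOneSpace X)), IsOpen U → ∀ g ∈ U, ∃ (F : Finset X) (δ : ℝ), 0 < δ ∧
      ∀ h : BaireOneSpace X, (∀ x ∈ F, |h.1 x - g.1 x| ≤ δ) → h ∈ U := by
    intro U hU g hg
    obtain ⟨V, hV, rfl⟩ := isOpen_induced_iff.1 hU
    obtain ⟨I, u, hu, hsub⟩ := isOpen_pi_iff.1 hV g.1 hg
    have : ∀ x : X, ∃ δ : ℝ, 0 < δ ∧ (x ∈ I → Metric.closedBall (g.1 x) δ ⊆ u x) := by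
      intro x
      by_cases hx : x ∈ I
      · obtain ⟨δ, h0, h1⟩ := Metric.nhds_basis_closedBall.mem_iff.1 ((hu x hx).1.mem_nhds (hu x hx).2)
        exact ⟨δ, h0, fun _ => h1⟩
      · exact ⟨1, one_pos, fun h => absurd h hx⟩
    choose δ hδ hδu using this
    obtain ⟨ε, hε, hle⟩ : ∃ ε : ℝ, 0 < ε ∧ ∀ x ∈ I, ε ≤ δ x := by
      by_cases hI : I.Nonempty
      · refine ⟨I.inf' hI δ, (Finset.lt_inf'_iff hI).2 fun x _ => hδ x, fun x hx => Finset.inf'_le _ hx⟩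
      · exact ⟨1, one_pos, fun x hx => absurd ⟨x, hx⟩ hI⟩
    refine ⟨I, ε, hε, fun h hh => hsub fun x hx => hδu x hx ?_⟩
    rw [Metric.mem_closedBall, Real.dist_eq]
    exact (hh x hx).trans (hle x hx)
  have boxOpen : ∀ (F : Finset X) (g : BaireOneSpace X) (ε : ℝ),
      IsOpen {h : BaireOneSpace X | ∀ x ∈ F, |h.1 x - g.1 x| < ε} := by
    intro F g ε
    have : {h : BaireOneSpace X | ∀ x ∈ F, |h.1 x - g.1 x| < ε} =
        ⋂ x ∈ F, {h : BaireOneSpace X | |h.1 x - g.1 x| < ε} := by ext; simp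
    rw [this]
    refine isOpen_biInter_finset fun x _ => ?_
    have hc : Continuous fun h : BaireOneSpace X => h.1 x :=
      (continuous_apply x).comp continuous_subtype_val
    exact isOpen_lt (hc.sub continuous_const).abs continuous_const
  have step : ∀ (n : ℕ) (s : St), ∃ t : St, s.1.1 ⊆ t.1.1 ∧
      (∀ x ∈ s.1.1, |t.1.2.1.1 x - s.1.2.1.1 x| + t.1.2.2 ≤ s.1.2.2) ∧
      ∀ h : BaireOneSpace X, (∀ x ∈ t.1.1, |h.1 x - t.1.2.1.1 x| ≤ t.1.2.2) → h ∈ O n := by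
    rintro n ⟨⟨F, g, ε⟩, hε⟩
    obtain ⟨g', hg'O, hg'⟩ := (hd n).exists_mem_open (boxOpen F g ε) ⟨g, by simpa using fun _ _ => hε⟩
    obtain ⟨F', δ, hδ, hF'⟩ := basic _ ((hO n).inter (boxOpen F g ε)) g' ⟨hg'O, hg'⟩ |>.imp fun _ h => h
    -- The margin `η` keeps the new closed box inside the old one at the points of `F`.
    obtain ⟨η, hη, hle⟩ : ∃ η : ℝ, 0 < η ∧ ∀ x ∈ F, |g'.1 x - g.1 x| + η ≤ ε := by
      by_cases hI : F.Nonempty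
      · refine ⟨F.inf' hI fun x => ε - |g'.1 x - g.1 x|,
          (Finset.lt_inf'_iff hI).2 fun x hx => sub_pos.2 (hg' x hx), fun x hx => ?_⟩
        have := Finset.inf'_le (fun x => ε - |g'.1 x - g.1 x|) hx
        linarith
      · exact ⟨1, one_pos, fun x hx => absurd ⟨x, hx⟩ hI⟩
    refine ⟨⟨⟨F ∪ F', g', min δ η⟩, lt_min hδ hη⟩, Finset.subset_union_left, fun x hx => ?_,
      fun h hh => ?_⟩
    · have := hle x hx
      have := min_le_right δ η
      simp only
      linarith
    · exact (hF' h fun x hx => (hh x (Finset.mem_union_right _ hx)).trans (min_le_left _ _)).1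
  choose next hnext1 hnext2 hnext3 using step
  refine dense_iff_inter_open.2 fun W hW ⟨g₀, hg₀⟩ => ?_
  obtain ⟨F₀, δ₀, hδ₀, hF₀⟩ := basic W hW g₀ hg₀
  let s : ℕ → St := fun n => Nat.rec ⟨⟨F₀, g₀, δ₀⟩, hδ₀⟩ (fun k t => next k t) n
  have hs : ∀ n, s (n + 1) = next n (s n) := fun n => rfl
  have hmono : Monotone fun n => (s n).1.1 :=
    monotone_nat_of_le_succ fun n => by rw [hs]; exact hnext1 n (s n)
  have hnest : ∀ x n m, n ≤ m → x ∈ (s n).1.1 →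
      |(s m).1.2.1.1 x - (s n).1.2.1.1 x| + (s m).1.2.2 ≤ (s n).1.2.2 := by
    intro x n m hnm hx
    induction m, hnm using Nat.le_induction with
    | base => simp
    | succ m hnm ih =>
      have h2 := hnext2 m (s m) x (hmono hnm hx)
      rw [← hs] at h2
      have := abs_sub_le ((s (m + 1)).1.2.1.1 x) ((s m).1.2.1.1 x) ((s n).1.2.1.1 x)
      linarith
  have hlim : ∀ x : X, ∃ t : ℝ, ∀ n, x ∈ (s n).1.1 → |t - (s n).1.2.1.1 x| ≤ (s n).1.2.2 := by
    intro x
    let A : Set ℝ := {y | ∃ n, x ∈ (s n).1.1 ∧ y = (s n).1.2.1.1 x - (s n).1.2.2}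
    have key : ∀ n m, x ∈ (s n).1.1 → x ∈ (s m).1.1 →
        (s n).1.2.1.1 x - (s n).1.2.2 ≤ (s m).1.2.1.1 x + (s m).1.2.2 := by
      intro n m hn hm
      have p1 := (s n).2
      have p2 := (s m).2
      rcases le_total n m with h | h
      · have := hnest x n m h hn
        have := abs_le.1 (le_refl |(s m).1.2.1.1 x - (s n).1.2.1.1 x|)
        linarith
      · have := hnest x m n h hm
        have := abs_le.1 (le_refl |(s n).1.2.1.1 x - (s m).1.2.1.1 x|)
        linarith
    -- By `key` the intervals at `x` meet pairwise, so the supremum of their left ends lies in all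
    -- of them. If no box constrains `x`, the value is irrelevant.
    refine ⟨sSup A, fun n hn => ?_⟩
    have hb : BddAbove A := ⟨_, by rintro _ ⟨k, hk, rfl⟩; exact key k n hk hn⟩
    have h1 : _ ≤ sSup A := le_csSup hb ⟨n, hn, rfl⟩
    have h2 : sSup A ≤ (s n).1.2.1.1 x + (s n).1.2.2 :=
      csSup_le ⟨_, n, hn, rfl⟩ (by rintro _ ⟨k, hk, rfl⟩; exact key k n hk hn)
    rw [abs_le]
    constructor <;> linarith
  choose φ hφ using hlim
  -- The limit `φ` need not be Baire-one, but only its values on this countable union matter.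
  obtain ⟨g, hg, hgφ⟩ := hext (⋃ n, ((s n).1.1 : Set X))
    (Set.countable_iUnion fun n => (s n).1.1.countable_toSet) φ
  have hgs : ∀ n, ∀ x ∈ (s n).1.1, |g x - (s n).1.2.1.1 x| ≤ (s n).1.2.2 := by
    intro n x hx
    rw [hgφ x (Set.mem_iUnion.2 ⟨n, hx⟩)]
    exact hφ x n hx
  refine ⟨⟨g, hg⟩, hF₀ _ (hgs 0), Set.mem_iInter.2 fun n => hnext3 n (s n) _ ?_⟩
  rw [← hs]
  exact hgs (n + 1)

/-- In a zero-dimensional space carrying a rank such that every point of a countable set `F` has a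
clopen neighbourhood whose other points in `F` have smaller rank, real functions on `F` extend to
Baire-one functions. -/
theorem exists_isBaireOne_extension {X ρ : Type*} [TopologicalSpace X] [LinearOrder ρ]
    [WellFoundedLT ρ]
    (rk : X → ρ) {F : Set X} (hF : F.Countable)
    (hU : ∀ x ∈ F, ∃ U : Set X, IsClopen U ∧ x ∈ U ∧ ∀ y ∈ F, y ∈ U → y ≠ x → rk y < rk x)
    (φ : X → ℝ) : ∃ g : X → ℝ, IsBaireOne g ∧ ∀ x ∈ F, g x = φ x := by
  classical
  rcases F.eq_empty_or_nonempty with rfl | hne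
  · exact ⟨fun _ => 0, ⟨fun _ _ => 0, fun _ => continuous_const, fun _ => tendsto_const_nhds⟩, by simp⟩
  obtain ⟨e, rfl⟩ := hF.exists_eq_range hne
  have hU' : ∀ n, ∃ U : Set X, IsClopen U ∧ e n ∈ U ∧ ∀ m, e m ∈ U → e m ≠ e n →
      rk (e m) < rk (e n) := fun n => by
    obtain ⟨U, h1, h2, h3⟩ := hU (e n) ⟨n, rfl⟩
    exact ⟨U, h1, h2, fun m => h3 _ ⟨m, rfl⟩⟩
  choose U hUc heU hUr using hU'
  -- Ties in rank are broken by the index, so each point covered by the `U n` has a unique first `U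
  -- n` containing it.
  let key : ℕ → ρ ×ₗ ℕ := fun n => toLex (rk (e n), n)
  have hkey : ∀ {m n}, key m = key n → m = n := fun h => (Prod.ext_iff.1 (toLex.injective h)).2
  -- Removing only the `U m` with `m < k` keeps this clopen. As `k` grows, the pieces at `x` reduce
  -- to the one with least key.
  let M : ℕ → ℕ → Set X := fun k n => U n \ ⋃ m ∈ (Finset.range k).filter (key · < key n), U m
  have hM : ∀ k n, IsClopen (M k n) := fun k n =>
    (hUc n).diff (Set.Finite.isClopen_biUnion (Finset.finite_toSet _) fun m _ => hUc m)
  let u : ℕ → X → ℝ := fun k x =>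
    ∑ n ∈ Finset.range k, (M k n).indicator (fun _ => φ (e n)) x
  have hu : ∀ k, Continuous (u k) := fun k =>
    continuous_finsetSum _ fun n _ => continuous_const.indicator fun x hx => by
      simp [(hM k n).frontier_eq] at hx
  have hlim : ∀ x, ∃ v, Tendsto (fun k => u k x) atTop (𝓝 v) ∧ (x ∈ Set.range e → v = φ x) := by
    intro x
    by_cases hN : ∃ n, x ∈ U n
    · obtain ⟨n₀, hn₀, hmin⟩ := WellFounded.has_min (InvImage.wf key wellFounded_lt) {n | x ∈ U n} hN
      have hmin' : ∀ n, x ∈ U n → n ≠ n₀ → key n₀ < key n := fun n hn hne =>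
        lt_of_le_of_ne (not_lt.1 (hmin n hn)) fun h => hne (hkey h).symm
      refine ⟨φ (e n₀), tendsto_const_nhds.congr' ?_, ?_⟩
      · filter_upwards [eventually_gt_atTop n₀] with k hk
        rw [eq_comm]
        show ∑ n ∈ Finset.range k, (M k n).indicator (fun _ => φ (e n)) x = _
        rw [Finset.sum_eq_single_of_mem n₀ (Finset.mem_range.2 hk)]
        · refine Set.indicator_of_mem (show x ∈ M k n₀ from ⟨hn₀, fun h => ?_⟩) _
          simp only [Set.mem_iUnion, Finset.mem_filter] at h
          obtain ⟨m, ⟨-, hm⟩, hxm⟩ := h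
          exact hmin m hxm hm
        · refine fun n _ hne => Set.indicator_of_notMem (fun h => ?_) _
          refine h.2 (Set.mem_biUnion (x := n₀) ?_ hn₀)
          simpa using ⟨hk, hmin' n h.1 hne⟩
      -- If `e n₀ ≠ e m`, then `e m ∈ U n₀` has smaller rank than `e n₀`, so `U m` would come before
      -- `U n₀`.
      · rintro ⟨m, rfl⟩
        by_contra hne
        have h1 := hUr n₀ m hn₀ fun h => hne (by rw [h])
        exact hmin m (heU m) (Prod.Lex.toLex_lt_toLex.2 (Or.inl h1))
    · refine ⟨0, tendsto_const_nhds.congr fun k => ?_, ?_⟩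
      · rw [eq_comm]
        exact Finset.sum_eq_zero fun n _ => Set.indicator_of_notMem (fun h => hN ⟨n, h.1⟩) _
      · rintro ⟨m, rfl⟩
        exact absurd ⟨m, heU m⟩ hN
  choose g hg hgφ using hlim
  exact ⟨g, ⟨u, hu, hg⟩, hgφ⟩

/-! ### Kunen's independent linked matrix. -/

/-- The trace of a set of natural numbers on an initial segment. -/
noncomputable def initTrace (X : Set ℕ) (k : ℕ) : Finset ℕ := by
  classical exact (Finset.range k).filter (· ∈ X)

/-- It suffices to go past one point of disagreement for each of the finitely many pairs. Counting
traces then amounts to counting sets. -/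
theorem exists_forall_ge_initTrace_injOn (s : Finset (Set ℕ)) :
    ∃ K, ∀ k ≥ K, Set.InjOn (fun X => initTrace X k) (s : Set (Set ℕ)) := by
  classical
  have h : ∀ p : Set ℕ × Set ℕ, ∃ m, p.1 ≠ p.2 → ¬ (m ∈ p.1 ↔ m ∈ p.2) := by
    intro p
    by_cases hp : p.1 = p.2
    · exact ⟨0, fun h => absurd hp h⟩
    · by_contra! hc
      exact hp (Set.ext fun m => (hc m).2)
  choose m hm using h
  refine ⟨(s ×ˢ s).sup (fun p => m p + 1), fun k hk X hX Y hY hXY => ?_⟩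
  by_contra hne
  have hlt : m (X, Y) < k := lt_of_lt_of_le (Nat.lt_succ_self _)
    ((Finset.le_sup (f := fun p => m p + 1) (Finset.mk_mem_product hX hY)).trans hk)
  refine hm (X, Y) hne ?_
  have := Finset.ext_iff.1 hXY (m (X, Y))
  simpa [initTrace, hlt] using this

/-- An independent linked matrix of sets on a countable set. -/
structure LinkedMatrix (S : Type*) where
  /-- the entries -/
  A : Set ℕ → Set ℕ → ℕ → Set S
  mono : ∀ i α, Monotone (A i α)
  finite : ∀ i n (s : Finset (Set ℕ)), n < s.card → (⋂ α ∈ s, A i α n).Finite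
  infinite : ∀ (t : Finset (Set ℕ)) (n : Set ℕ → ℕ) (s : Set ℕ → Finset (Set ℕ)),
    (∀ i ∈ t, (s i).card ≤ n i) → (⋂ i ∈ t, ⋂ α ∈ s i, A i α (n i)).Infinite

/-- The entries of Kunen's matrix. -/
noncomputable def kunenEntry (X Y : Set ℕ) (n : ℕ) : Set (ℕ × Finset (Finset ℕ × Finset ℕ)) :=
  {p | p.2 ⊆ (Finset.range p.1).powerset ×ˢ (Finset.range p.1).powerset ∧
    (p.2.filter fun q => q.1 = initTrace X p.1).card ≤ n ∧
    (initTrace X p.1, initTrace Y p.1) ∈ p.2}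

theorem initTrace_mem_powerset (X : Set ℕ) (k : ℕ) : initTrace X k ∈ (Finset.range k).powerset := by
  classical
  rw [Finset.mem_powerset]
  exact Finset.filter_subset _ _

/-- Kunen's matrix. -/
noncomputable def kunenMatrix : LinkedMatrix (ℕ × Finset (Finset ℕ × Finset ℕ)) where
  A := kunenEntry
  mono := fun _ _ _ _ hnm _ hp => ⟨hp.1, hp.2.1.trans hnm, hp.2.2⟩
  finite := by
    classical
    intro X n s hs
    obtain ⟨K, hK⟩ := exists_forall_ge_initTrace_injOn s
    refine Set.Finite.subset ((Finset.range K ×ˢ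
      ((Finset.range K).powerset ×ˢ (Finset.range K).powerset).powerset).finite_toSet) fun p hp => ?_
    simp only [Set.mem_iInter] at hp
    obtain ⟨Y₀, hY₀⟩ := Finset.card_pos.1 (lt_of_le_of_lt (Nat.zero_le _) hs)
    -- Beyond `K` the columns in `s` give distinct pairs over the trace of `X`, more than the `n`
    -- allowed.
    have hlt : p.1 < K := by
      by_contra hge
      have hsub : s.image (fun Y => (initTrace X p.1, initTrace Y p.1)) ⊆
          p.2.filter fun q => q.1 = initTrace X p.1 := by
        intro q hq
        obtain ⟨Y, hY, rfl⟩ := Finset.mem_image.1 hq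
        exact Finset.mem_filter.2 ⟨(hp Y hY).2.2, rfl⟩
      have h1 := Finset.card_le_card hsub
      rw [Finset.card_image_of_injOn fun Y hY Y' hY' h =>
        hK p.1 (not_lt.1 hge) hY hY' (Prod.ext_iff.1 h).2] at h1
      exact absurd (h1.trans (hp Y₀ hY₀).2.1) (not_le.2 hs)
    have hr : (Finset.range p.1).powerset ⊆ (Finset.range K).powerset :=
      Finset.powerset_mono.2 (Finset.range_mono hlt.le)
    simp only [Finset.coe_product, Set.mem_prod, Finset.mem_coe, Finset.mem_range,
      Finset.mem_powerset]
    exact ⟨hlt, (hp Y₀ hY₀).1.trans (Finset.product_subset_product hr hr)⟩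
  infinite := by
    classical
    intro t n s hs
    obtain ⟨K, hK⟩ := exists_forall_ge_initTrace_injOn t
    -- Only the required pairs are put in. Past `K` the rows have distinct traces, so the pairs over
    -- row `i` come from `s i` alone.
    let f : ℕ → Finset (Finset ℕ × Finset ℕ) := fun k =>
      t.biUnion fun i => (s i).image fun Y => (initTrace i k, initTrace Y k)
    refine Set.infinite_of_injective_forall_mem (f := fun k => (k + K, f (k + K))) ?_ ?_
    · intro a b h
      simpa using (Prod.ext_iff.1 h).1
    · intro k
      simp only [Set.mem_iInter]
      intro i hi Y hY
      refine ⟨?_, ?_, ?_⟩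
      · intro q hq
        simp only [f, Finset.mem_biUnion, Finset.mem_image] at hq
        obtain ⟨j, -, Z, -, rfl⟩ := hq
        exact Finset.mk_mem_product (initTrace_mem_powerset _ _) (initTrace_mem_powerset _ _)
      · refine le_trans (Finset.card_le_card (t := (s i).image
          fun Y => (initTrace i (k + K), initTrace Y (k + K))) ?_) (Finset.card_image_le.trans (hs i hi))
        intro q hq
        simp only [f, Finset.mem_filter, Finset.mem_biUnion, Finset.mem_image] at hq
        obtain ⟨⟨j, hj, Z, hZ, rfl⟩, h2⟩ := hq
        obtain rfl := hK (k + K) (Nat.le_add_left _ _) hj hi h2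
        exact Finset.mem_image_of_mem _ hZ
      · simp only [f, Finset.mem_biUnion, Finset.mem_image]
        exact ⟨i, hi, Y, hY, rfl⟩

/-! ### An ultrafilter with the OK property, by transfinite recursion. -/

namespace LinkedMatrix

variable {S : Type*} (L : LinkedMatrix S)

/-- The intersections of finitely many entries allowed by linkedness, using rows outside `J`. -/
def Cond (J : Set (Set ℕ)) : Set (Set S) :=
  {M | ∃ (t : Finset (Set ℕ)) (n : Set ℕ → ℕ) (s : Set ℕ → Finset (Set ℕ)),
    (∀ i ∈ t, i ∉ J ∧ (s i).card ≤ n i) ∧ M = ⋂ i ∈ t, ⋂ α ∈ s i, L.A i α (n i)}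

/-- The rows outside `J` are independent with respect to the filter `F`. -/
def Indep (F : Filter S) (J : Set (Set ℕ)) : Prop :=
  ∀ a ∈ F, ∀ M ∈ L.Cond J, (a ∩ M).Infinite

variable {L}

theorem Cond.mono {J J' : Set (Set ℕ)} (h : J ⊆ J') : L.Cond J' ⊆ L.Cond J := by
  rintro M ⟨t, n, s, hs, rfl⟩
  exact ⟨t, n, s, fun i hi => ⟨fun hJ => (hs i hi).1 (h hJ), (hs i hi).2⟩, rfl⟩

theorem univ_mem_cond (J : Set (Set ℕ)) : Set.univ ∈ L.Cond J :=
  ⟨∅, fun _ => 0, fun _ => ∅, by simp, by simp⟩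

/-- Conditions on disjoint sets of rows can be merged. -/
theorem inter_mem_cond {J : Set (Set ℕ)} {t : Finset (Set ℕ)} {n : Set ℕ → ℕ}
    {s : Set ℕ → Finset (Set ℕ)} (hs : ∀ i ∈ t, i ∉ J ∧ (s i).card ≤ n i) {M : Set S}
    (hM : M ∈ L.Cond (J ∪ t)) : (⋂ i ∈ t, ⋂ α ∈ s i, L.A i α (n i)) ∩ M ∈ L.Cond J := by
  classical
  obtain ⟨t', n', s', hs', rfl⟩ := hM
  have hd : ∀ i ∈ t', i ∉ t := fun i hi h => (hs' i hi).1 (Or.inr h)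
  refine ⟨t ∪ t', fun i => if i ∈ t then n i else n' i, fun i => if i ∈ t then s i else s' i,
    fun i hi => ?_, ?_⟩
  · by_cases h : i ∈ t
    · simpa [h] using hs i h
    · have hi' := (Finset.mem_union.1 hi).resolve_left h
      simpa [h] using ⟨fun hJ => (hs' i hi').1 (Or.inl hJ), (hs' i hi').2⟩
  · simp only [Finset.mem_union, Set.iInter_or, Set.iInter_inter_distrib]
    congr 1
    · exact Set.iInter₂_congr fun i hi => by simp [hi]
    · exact Set.iInter₂_congr fun i hi => by simp [hd i hi]

/-- A decreasing sequence `U` is handled by `F`: either it leaves `F`, or `F` contains it together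
with a family witnessing the OK property for it. -/
def Handles (F : Filter S) (U : ℕ → Set S) : Prop :=
  (∃ n, (U n)ᶜ ∈ F) ∨ ((∀ n, U n ∈ F) ∧ ∃ V : Set ℕ → Set S, (∀ α, V α ∈ F) ∧
    ∀ s : Finset (Set ℕ), s.Nonempty → ((⋂ α ∈ s, V α) \ U s.card).Finite)

theorem Handles.mono {F G : Filter S} {U : ℕ → Set S} (h : Handles F U) (hle : G ≤ F) :
    Handles G U := by
  rcases h with ⟨n, hn⟩ | ⟨h1, V, h2, h3⟩
  · exact Or.inl ⟨n, hle hn⟩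
  · exact Or.inr ⟨fun n => hle (h1 n), V, fun α => hle (h2 α), h3⟩

/-- If adjoining the `U n` preserves independence, one row `i` is spent on the sets `V α`. A point
of all `V α`, `α ∈ s`, outside `U s.card` lies in entries of index below `s.card`, and `s.card` such
entries have finite intersection. Otherwise some condition `M` almost misses `a ∩ U n`; adjoining
`M` expels `U n` and costs only the finitely many rows of `M`. -/
theorem Indep.exists_handles {F : Filter S} {J : Set (Set ℕ)} (hF : L.Indep F J)
    (hco : F ≤ cofinite) {i : Set ℕ} (hi : i ∉ J) {U : ℕ → Set S} (hU : Antitone U) :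
    ∃ (G : Filter S) (D : Finset (Set ℕ)), G ≤ F ∧ L.Indep G (J ∪ D) ∧ Handles G U := by
  classical
  by_cases hcase : ∀ n, ∀ a ∈ F, ∀ M ∈ L.Cond J, (a ∩ U n ∩ M).Infinite
  · let V : Set ℕ → Set S := fun α => ⋃ m, L.A i α m ∩ U m
    refine ⟨F ⊓ (⨅ n, 𝓟 (U n)) ⊓ ⨅ α, 𝓟 (V α), {i}, inf_le_left.trans inf_le_left, ?_,
      Or.inr ⟨fun n => ?_, V, fun α => ?_, ?_⟩⟩
    · intro x hx M hM
      obtain ⟨⟨⟨a, n⟩, s⟩, ⟨⟨ha, -⟩, hs⟩, hsub⟩ := (((F.basis_sets.inf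
        (hasBasis_iInf_principal (s := U) (directed_of_isDirected_le hU))).inf
        (hasBasis_iInf_principal_finite V)).mem_iff).1 hx
      simp only [id] at ha hsub
      have hs : s.Finite := hs
      -- Index `N` is large enough for linkedness to allow all columns in `s`, and `U N ⊆ U n`.
      let N := max n hs.toFinset.card
      have hM' := inter_mem_cond (L := L) (J := J) (t := {i}) (n := fun _ => N)
        (s := fun _ => hs.toFinset) (by simpa [N] using hi) hM
      refine (hcase N a ha _ hM').mono ?_
      rintro y ⟨⟨hya, hyU⟩, hyA, hyM⟩
      refine ⟨hsub ⟨⟨hya, hU (le_max_left _ _) hyU⟩, ?_⟩, hyM⟩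
      simp only [Set.mem_iInter] at hyA ⊢
      exact fun α hα => Set.mem_iUnion.2 ⟨N, hyA i (by simp) α (by simpa using hα), hyU⟩
    · exact mem_inf_of_left (mem_inf_of_right (mem_iInf_of_mem n (mem_principal_self _)))
    · exact mem_inf_of_right (mem_iInf_of_mem α (mem_principal_self _))
    · intro s hs
      refine (L.finite i (s.card - 1) s (Nat.sub_lt hs.card_pos one_pos)).subset ?_
      rintro y ⟨hyV, hyU⟩
      simp only [Set.mem_iInter] at hyV ⊢
      intro α hα
      obtain ⟨m, hm, hmU⟩ := Set.mem_iUnion.1 (hyV α hα)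
      refine L.mono i α ?_ hm
      by_contra hlt
      exact hyU (hU (by omega) hmU)
  · push Not at hcase
    obtain ⟨n, a, ha, M, ⟨t, k, s, hs, rfl⟩, hfin⟩ := hcase
    refine ⟨F ⊓ 𝓟 (⋂ i ∈ t, ⋂ α ∈ s i, L.A i α (k i)), t, inf_le_left, ?_, Or.inl ⟨n, ?_⟩⟩
    · intro x hx M hM
      refine (hF _ (mem_inf_principal.1 hx) _ (inter_mem_cond hs hM)).mono ?_
      rintro y ⟨h1, h2, h3⟩
      exact ⟨h1 h2, h3⟩
    · rw [mem_inf_principal]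
      filter_upwards [ha, hco hfin.compl_mem_cofinite] with y hya hy hyM hyU
      exact hy ⟨⟨hya, hyU⟩, hyM⟩

end LinkedMatrix

namespace LinkedMatrix

open Cardinal in
/-- The rows used at the earlier stages of a short recursion do not exhaust all rows. -/
theorem exists_notMem_iUnion_finset {ι : Type} (hι : #ι < 𝔠) (D : ι → Finset (Set ℕ)) :
    ∃ i, i ∉ ⋃ η, (D η : Set (Set ℕ)) := by
  by_contra! h
  have h1 : (⋃ η, (D η : Set (Set ℕ))) = Set.univ := Set.eq_univ_of_forall h
  have h2 : #(⋃ η, (D η : Set (Set ℕ))) ≤ #ι * ℵ₀ := by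
    refine mk_iUnion_le_sum_mk.trans ?_
    refine (sum_le_sum _ (fun _ => ℵ₀) fun η => (D η).countable_toSet.le_aleph0).trans ?_
    simp
  rw [h1, mk_univ, mk_set, mk_nat, two_power_aleph0] at h2
  exact absurd h2 (not_le.2 (mul_lt_of_lt aleph0_le_continuum hι aleph0_lt_continuum))

/-- Transfinite recursion handling a well-ordered family of decreasing sequences of sets. -/
theorem exists_filter_handles {S : Type} (L : LinkedMatrix S) {T : Type} [LinearOrder T]
    [WellFoundedLT T] [Nonempty T] (hT : ∀ ξ : T, Cardinal.mk (Set.Iio ξ) < Cardinal.continuum)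
    (U : T → ℕ → Set S) (hU : ∀ ξ, Antitone (U ξ)) :
    ∃ F : Filter S, F ≤ cofinite ∧ F.NeBot ∧ ∀ ξ, Handles F (U ξ) := by
  classical
  let pre : ∀ ξ : T, (∀ η < ξ, Filter S × Finset (Set ℕ)) → Filter S := fun ξ g =>
    cofinite ⊓ ⨅ η : Set.Iio ξ, (g η.1 η.2).1
  let used : ∀ ξ : T, (∀ η < ξ, Filter S × Finset (Set ℕ)) → Set (Set ℕ) := fun ξ g =>
    ⋃ η : Set.Iio ξ, ((g η.1 η.2).2 : Set (Set ℕ))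
  -- Independence is a premise here because the recursion does not carry the invariant; `hind`
  -- proves it afterwards by induction.
  have step : ∀ (ξ : T) (g : ∀ η < ξ, Filter S × Finset (Set ℕ)),
      ∃ p : Filter S × Finset (Set ℕ), p.1 ≤ pre ξ g ∧ (L.Indep (pre ξ g) (used ξ g) →
        L.Indep p.1 (used ξ g ∪ p.2) ∧ Handles p.1 (U ξ)) := by
    intro ξ g
    by_cases h : L.Indep (pre ξ g) (used ξ g)
    · obtain ⟨i, hi⟩ := exists_notMem_iUnion_finset (hT ξ) fun η => (g η.1 η.2).2
      obtain ⟨G, D, h1, h2, h3⟩ := h.exists_handles inf_le_left hi (hU ξ)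
      exact ⟨(G, D), h1, fun _ => ⟨h2, h3⟩⟩
    · exact ⟨(pre ξ g, ∅), le_rfl, fun h' => absurd h' h⟩
  choose next hle hnext using step
  let G : T → Filter S × Finset (Set ℕ) := wellFounded_lt.fix next
  have hG : ∀ ξ, G ξ = next ξ fun η _ => G η := fun ξ => wellFounded_lt.fix_eq next ξ
  have hGle : ∀ ξ, (G ξ).1 ≤ pre ξ fun η _ => G η := fun ξ => by
    rw [hG ξ]
    exact hle ξ _
  have hanti : Antitone fun ξ => (G ξ).1 := by
    intro η ξ h
    rcases h.eq_or_lt with rfl | h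
    · exact le_rfl
    · exact (hGle ξ).trans (inf_le_right.trans (iInf_le (fun ζ : Set.Iio ξ => (G ζ.1).1) ⟨η, h⟩))
  have hco : ∀ ξ, (G ξ).1 ≤ cofinite := fun ξ => (hGle ξ).trans inf_le_left
  have hind : ∀ ξ, L.Indep (pre ξ fun η _ => G η) (used ξ fun η _ => G η) := by
    intro ξ
    refine wellFounded_lt.induction (C := fun ξ => L.Indep (pre ξ fun η _ => G η)
      (used ξ fun η _ => G η)) ξ fun ξ ih => ?_
    intro a ha M hM
    -- At the least stage the filter is `cofinite`, and independence is the `infinite` field. Later,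
    -- the earlier filters form a chain, so `a` already belongs to one of them.
    rcases isEmpty_or_nonempty (Set.Iio ξ) with hemp | hne
    · have hfin : aᶜ.Finite := by
        have : a ∈ (cofinite : Filter S) := by simpa [pre, iInf_of_empty] using ha
        exact this
      obtain ⟨t, n, s, hs, rfl⟩ := hM
      refine ((L.infinite t n s fun i hi => (hs i hi).2).sdiff hfin).mono ?_
      rintro y ⟨h1, h2⟩
      exact ⟨not_not.1 h2, h1⟩
    · have hle' : (⨅ η : Set.Iio ξ, (G η.1).1) ≤ pre ξ fun η _ => G η :=
        le_inf ((iInf_le _ hne.some).trans (hco _)) le_rfl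
      obtain ⟨η, hη⟩ := (mem_iInf_of_directed (f := fun η : Set.Iio ξ => (G η.1).1)
        (directed_of_isDirected_le fun a b h => hanti h) a).1 (hle' ha)
      have h1 := (hnext η.1 (fun ζ _ => G ζ) (ih η.1 η.2)).1
      rw [← hG] at h1
      refine h1 a hη M (Cond.mono ?_ hM)
      refine Set.union_subset (Set.iUnion_subset fun ζ => ?_) ?_
      · exact Set.subset_iUnion (fun ζ : Set.Iio ξ => ((G ζ.1).2 : Set (Set ℕ)))
          ⟨ζ.1, lt_trans ζ.2 η.2⟩
      · exact Set.subset_iUnion (fun ζ : Set.Iio ξ => ((G ζ.1).2 : Set (Set ℕ))) η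
  have hfinal : ∀ ξ, L.Indep (G ξ).1 ((used ξ fun η _ => G η) ∪ (G ξ).2) ∧
      Handles (G ξ).1 (U ξ) := fun ξ => by
    rw [hG ξ]
    exact hnext ξ _ (hind ξ)
  refine ⟨⨅ ξ, (G ξ).1, (iInf_le _ (Classical.arbitrary T)).trans (hco _),
    iInf_neBot_of_directed' (directed_of_isDirected_le fun a b h => hanti h) fun ξ => ?_,
    fun ξ => (hfinal ξ).2.mono (iInf_le _ ξ)⟩
  refine ⟨fun h => ?_⟩
  have := (hfinal ξ).1 ∅ (by rw [h]; exact mem_bot) _ (univ_mem_cond _)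
  simp at this

open Cardinal in
/-- Over an independent linked matrix on a countable set there is a free ultrafilter with the
OK property. -/
theorem exists_ultrafilter_ok {S : Type} [Countable S] (L : LinkedMatrix S) :
    ∃ 𝒰 : Ultrafilter S, (𝒰 : Filter S) ≤ cofinite ∧ ∀ U : ℕ → Set S, Antitone U →
      (∀ n, U n ∈ 𝒰) → ∃ V : Set ℕ → Set S, (∀ α, V α ∈ 𝒰) ∧
        ∀ s : Finset (Set ℕ), s.Nonempty → ((⋂ α ∈ s, V α) \ U s.card).Finite := by
  let R := {U : ℕ → Set S // Antitone U}
  have hR : #R ≤ 𝔠 := by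
    refine (mk_subtype_le _).trans ?_
    rw [← power_def, mk_set, mk_nat, ← power_mul, ← two_power_aleph0]
    refine power_le_power_left two_ne_zero ?_
    exact (mul_le_mul' (mk_le_aleph0 (α := S)) le_rfl).trans aleph0_mul_aleph0.le
  have : Nonempty R := ⟨⟨fun _ => Set.univ, antitone_const⟩⟩
  -- Indexing by an initial ordinal makes every proper initial segment smaller than `#R ≤ 𝔠`.
  let T := (#R).ord.ToType
  have e : T ≃ R := (Cardinal.eq.1 (by simp [T])).some
  have : Nonempty T := e.nonempty
  have hT : ∀ ξ : T, #(Set.Iio ξ) < 𝔠 := fun ξ =>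
    lt_of_lt_of_le (by simpa [T] using mk_Iio_lt ξ (by simp [T])) hR
  obtain ⟨F, hco, hne, hF⟩ := L.exists_filter_handles hT (fun ξ => (e ξ).1) fun ξ => (e ξ).2
  have hF' : ∀ U : ℕ → Set S, Antitone U → Handles F U := fun U hU => by
    simpa using hF (e.symm ⟨U, hU⟩)
  have hult : ∀ s, sᶜ ∉ F ↔ s ∈ F := by
    intro s
    refine ⟨fun h => ?_, fun h h' => ?_⟩
    -- Handling the constant sequence `s` decides `s`, so `F` is already an ultrafilter.
    · rcases hF' (fun _ => s) antitone_const with ⟨n, hn⟩ | ⟨hn, -⟩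
      · exact absurd hn h
      · exact hn 0
    · exact hne.ne (empty_mem_iff_bot.1 (by simpa using inter_mem h h'))
  refine ⟨Ultrafilter.ofComplNotMemIff F hult, hco, fun U hU hmem => ?_⟩
  rcases hF' U hU with ⟨n, hn⟩ | ⟨-, hV⟩
  · exact absurd hn ((hult _).2 (hmem n))
  · exact hV

end LinkedMatrix

/-! ### Weak P-points. -/

/-- A weak P-point: a free ultrafilter outside the closure of every countable set of other free
ultrafilters. -/
def IsWeakPPoint {S : Type*} (𝒰 : Ultrafilter S) : Prop :=
  (𝒰 : Filter S) ≤ cofinite ∧ ∀ Q : Set (Ultrafilter S), Q.Countable →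
    (∀ q ∈ Q, (q : Filter S) ≤ cofinite ∧ q ≠ 𝒰) → ∃ V ∈ 𝒰, ∀ q ∈ Q, V ∉ q

/-- Kunen's theorem: weak P-points exist. -/
theorem exists_isWeakPPoint :
    ∃ 𝒰 : Ultrafilter (ℕ × Finset (Finset ℕ × Finset ℕ)), IsWeakPPoint 𝒰 := by
  obtain ⟨𝒰, hco, hok⟩ := kunenMatrix.exists_ultrafilter_ok
  refine ⟨𝒰, hco, fun Q hQ hfree => ?_⟩
  rcases Q.eq_empty_or_nonempty with rfl | hne
  · exact ⟨Set.univ, univ_mem, by simp⟩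
  obtain ⟨q, rfl⟩ := hQ.exists_eq_range hne
  have hsep : ∀ k, ∃ W ∈ 𝒰, W ∉ q k := fun k => by
    by_contra! h
    exact (hfree _ ⟨k, rfl⟩).2 (Ultrafilter.coe_le_coe.1 h)
  choose W hW hWq using hsep
  let U : ℕ → Set (ℕ × Finset (Finset ℕ × Finset ℕ)) := fun n => ⋂ k ∈ Finset.range n, W k
  have hU : Antitone U := fun m n h =>
    Set.biInter_subset_biInter_left fun k hk => Finset.range_mono h hk
  obtain ⟨V, hV, hlink⟩ := hok U hU fun n => (biInter_finset_mem _).2 fun k _ => hW k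
  by_contra! hcon
  have hcon' : ∀ α, ∃ k, V α ∈ q k := fun α => by
    obtain ⟨_, ⟨k, rfl⟩, h⟩ := hcon (V α) (hV α)
    exact ⟨k, h⟩
  choose k hk using hcon'
  -- Pigeonhole: uncountably many `α` are distributed over countably many `q k`.
  obtain ⟨m, hm⟩ : ∃ m, (k ⁻¹' {m}).Infinite := by
    by_contra! h
    have : (Set.univ : Set (Set ℕ)).Countable := by
      rw [← Set.preimage_univ (f := k), ← Set.iUnion_of_singleton, Set.preimage_iUnion]
      exact Set.countable_iUnion fun m => (h m).countable
    rw [← Cardinal.le_aleph0_iff_set_countable, Cardinal.mk_univ, Cardinal.mk_set, Cardinal.mk_nat,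
      Cardinal.two_power_aleph0] at this
    exact absurd this (not_le.2 Cardinal.aleph0_lt_continuum)
  -- With `m + 1` indices the OK property puts `U (m + 1)` into `q m`, and `U (m + 1) ⊆ W m`.
  obtain ⟨s, hs, hcard⟩ := hm.exists_subset_card_eq (m + 1)
  have hmem : (⋂ α ∈ s, V α) ∈ q m := (biInter_finset_mem _).2 fun α hα => by
    have : k α = m := hs hα
    exact this ▸ hk α
  have hfin := hlink s (Finset.card_pos.1 (by omega))
  have : U s.card ∈ q m := by
    filter_upwards [hmem, (hfree _ ⟨m, rfl⟩).1 hfin.compl_mem_cofinite] with y h1 h2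
    by_contra h3
    exact h2 ⟨h1, h3⟩
  refine hWq m (mem_of_superset this fun y hy => ?_)
  simp only [U, Set.mem_iInter] at hy
  exact hy m (by simp [hcard])

/-! ### The Stone space of a σ-algebra. -/

/-- The Stone space of the σ-algebra of measurable sets, as a space of Boolean homomorphisms. -/
abbrev MeasStone (Ω : Type*) [MeasurableSpace Ω] : Type _ :=
  {p : {b : Set Ω // MeasurableSet b} → Bool // p ⟨Set.univ, MeasurableSet.univ⟩ = true ∧
    (∀ a b, p ⟨a.1 ∩ b.1, a.2.inter b.2⟩ = (p a && p b)) ∧ ∀ a, p ⟨a.1ᶜ, a.2.compl⟩ = !p a}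

namespace MeasStone

variable {Ω : Type*} [MeasurableSpace Ω]

/-- The measurable set `b` belongs to the point `p`. -/
def Has (p : MeasStone Ω) (b : Set Ω) : Prop := ∃ h : MeasurableSet b, p.1 ⟨b, h⟩ = true

variable {p q : MeasStone Ω} {a b : Set Ω}

theorem Has.measurableSet (h : p.Has b) : MeasurableSet b := h.1

theorem has_univ (p : MeasStone Ω) : p.Has Set.univ := ⟨_, p.2.1⟩

theorem Has.inter (ha : p.Has a) (hb : p.Has b) : p.Has (a ∩ b) := by
  obtain ⟨ha, ha'⟩ := ha
  obtain ⟨hb, hb'⟩ := hb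
  exact ⟨ha.inter hb, by rw [p.2.2.1 ⟨a, ha⟩ ⟨b, hb⟩, ha', hb']; rfl⟩

theorem Has.mono (ha : p.Has a) (h : a ⊆ b) (hb : MeasurableSet b) : p.Has b := by
  obtain ⟨ha, ha'⟩ := ha
  have h1 := p.2.2.1 ⟨a, ha⟩ ⟨b, hb⟩
  simp only [Set.inter_eq_left.2 h, ha', Bool.true_and] at h1
  exact ⟨hb, h1.symm⟩

theorem has_compl_iff (hb : MeasurableSet b) : p.Has bᶜ ↔ ¬ p.Has b := by
  have h := p.2.2.2 ⟨b, hb⟩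
  simp only [Has, hb, hb.compl, exists_true_left]
  rw [h]
  simp

theorem not_has_empty (p : MeasStone Ω) : ¬ p.Has ∅ := by
  rw [← has_compl_iff MeasurableSet.empty, Set.compl_empty]
  exact p.has_univ

theorem Has.not_has_of_disjoint (ha : p.Has a) (h : Disjoint a b) : ¬ p.Has b := fun hb => by
  have := ha.inter hb
  rw [h.inter_eq] at this
  exact p.not_has_empty this

theorem has_biInter_finset {ι : Type*} {s : Finset ι} {f : ι → Set Ω} (h : ∀ i ∈ s, p.Has (f i)) :
    p.Has (⋂ i ∈ s, f i) := by
  classical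
  induction s using Finset.induction_on with
  | empty => simpa using p.has_univ
  | insert i s _ ih =>
    rw [Finset.set_biInter_insert]
    exact (h i (by simp)).inter (ih fun j hj => h j (by simp [hj]))

theorem exists_has_of_mem_nhds {U : Set (MeasStone Ω)} (hU : U ∈ 𝓝 p) :
    ∃ b, p.Has b ∧ ∀ q : MeasStone Ω, q.Has b → q ∈ U := by
  classical
  obtain ⟨V, hV, hVo, hpV⟩ := mem_nhds_iff.1 hU
  obtain ⟨W, hW, rfl⟩ := isOpen_induced_iff.1 hVo
  obtain ⟨I, u, hu, hsub⟩ := isOpen_pi_iff.1 hW p.1 hpV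
  have key : ∀ (a : {b : Set Ω // MeasurableSet b}) (q : MeasStone Ω),
      q.Has (if p.1 a = true then a.1 else a.1ᶜ) ↔ q.1 a = p.1 a := by
    intro a q
    by_cases h : p.1 a = true
    · simp [h, Has, a.2]
    · rw [if_neg h, has_compl_iff a.2]
      simp [h, Has, a.2]
  refine ⟨⋂ a ∈ I, if p.1 a = true then a.1 else a.1ᶜ,
    has_biInter_finset fun a _ => (key a p).2 rfl, fun q hq => hV (hsub fun a ha => ?_)⟩
  have := (key a q).1 (hq.mono (Set.biInter_subset_of_mem ha) (by split_ifs <;> simp [a.2]))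
  rw [this]
  exact (hu a ha).2

theorem isClopen_setOf_has (b : Set Ω) : IsClopen {p : MeasStone Ω | p.Has b} := by
  by_cases hb : MeasurableSet b
  · have : {p : MeasStone Ω | p.Has b} = (fun p : MeasStone Ω => p.1 ⟨b, hb⟩) ⁻¹' {true} := by
      ext p
      simp [Has, hb]
    rw [this]
    exact (isClopen_discrete _).preimage ((continuous_apply _).comp continuous_subtype_val)
  · have : {p : MeasStone Ω | p.Has b} = ∅ := by
      ext p
      simp [Has, hb]
    rw [this]
    exact isClopen_empty

theorem exists_has_of_notMem_closure {C : Set (MeasStone Ω)} (h : p ∉ closure C) :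
    ∃ b, p.Has b ∧ ∀ q ∈ C, ¬ q.Has b := by
  obtain ⟨b, h1, h2⟩ := exists_has_of_mem_nhds (isClosed_closure.isOpen_compl.mem_nhds h)
  exact ⟨b, h1, fun q hq hb => h2 q hb (subset_closure hq)⟩

theorem notMem_closure_of_has {C : Set (MeasStone Ω)} (hp : p.Has b) (hC : ∀ q ∈ C, ¬ q.Has b) :
    p ∉ closure C := fun h => by
  obtain ⟨q, hq, hqC⟩ := mem_closure_iff.1 h _ (isClopen_setOf_has b).isOpen hp
  exact hC q hqC hq

theorem exists_has_of_ne (h : q ≠ p) : ∃ b, p.Has b ∧ ¬ q.Has b := by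
  obtain ⟨b, h1, h2⟩ := exists_has_of_notMem_closure (p := p) (C := {q}) (by simpa using h.symm)
  exact ⟨b, h1, h2 q rfl⟩

/-- Countable sets disjoint from each other's closures are separated by a measurable set. -/
theorem exists_separating_of_countable {P Q : Set (MeasStone Ω)} (hP : P.Countable)
    (hQ : Q.Countable) (hPQ : ∀ p ∈ P, p ∉ closure Q) (hQP : ∀ q ∈ Q, q ∉ closure P) :
    ∃ b, MeasurableSet b ∧ (∀ p ∈ P, p.Has b) ∧ ∀ q ∈ Q, ¬ q.Has b := by
  rcases P.eq_empty_or_nonempty with rfl | hPne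
  · exact ⟨∅, MeasurableSet.empty, by simp, fun q _ => q.not_has_empty⟩
  rcases Q.eq_empty_or_nonempty with rfl | hQne
  · exact ⟨Set.univ, MeasurableSet.univ, fun p _ => p.has_univ, by simp⟩
  obtain ⟨x, rfl⟩ := hP.exists_eq_range hPne
  obtain ⟨y, rfl⟩ := hQ.exists_eq_range hQne
  choose b hb hb' using fun n => exists_has_of_notMem_closure (hPQ (x n) ⟨n, rfl⟩)
  choose c hc hc' using fun n => exists_has_of_notMem_closure (hQP (y n) ⟨n, rfl⟩)
  have hm : ∀ n, MeasurableSet (b n ∩ ⋂ m ∈ Finset.range (n + 1), (c m)ᶜ) := fun n =>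
    (hb n).measurableSet.inter (Finset.measurableSet_biInter _ fun m _ => (hc m).measurableSet.compl)
  refine ⟨⋃ n, b n ∩ ⋂ m ∈ Finset.range (n + 1), (c m)ᶜ, MeasurableSet.iUnion hm, ?_, ?_⟩
  · rintro _ ⟨n, rfl⟩
    refine Has.mono ((hb n).inter (has_biInter_finset (s := Finset.range (n + 1)) fun m _ => ?_))
      (Set.subset_iUnion (fun n => b n ∩ ⋂ m ∈ Finset.range (n + 1), (c m)ᶜ) n)
      (MeasurableSet.iUnion hm)
    exact (has_compl_iff (hc m).measurableSet).2 (hc' m _ ⟨n, rfl⟩)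
  · rintro _ ⟨m, rfl⟩ h
    -- The pieces with `n < m` are avoided because `y m` misses `b n`, those with `n ≥ m` because
    -- they exclude `c m`.
    have h1 : (y m).Has (⋂ n ∈ Finset.range m, (b n)ᶜ) := has_biInter_finset fun n _ =>
      (has_compl_iff (hb n).measurableSet).2 (hb' n _ ⟨m, rfl⟩)
    refine ((hc m).inter h1).not_has_of_disjoint (Set.disjoint_left.2 ?_) h
    rintro z ⟨hz1, hz2⟩ hz3
    simp only [Set.mem_iInter, Finset.mem_range, Set.mem_compl_iff] at hz2
    obtain ⟨n, hn, hn'⟩ := Set.mem_iUnion.1 hz3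
    simp only [Set.mem_iInter, Finset.mem_range, Set.mem_compl_iff] at hn'
    rcases lt_or_ge n m with hnm | hnm
    · exact hz2 n hnm hn
    · exact hn' m (by omega) hz1

open Classical in
/-- The point given by a predicate that is a Boolean homomorphism on measurable sets. -/
noncomputable def ofPred (P : Set Ω → Prop) (hu : P Set.univ)
    (hi : ∀ a b, MeasurableSet a → MeasurableSet b → (P (a ∩ b) ↔ P a ∧ P b))
    (hc : ∀ a, MeasurableSet a → (P aᶜ ↔ ¬ P a)) : MeasStone Ω :=
  ⟨fun b => decide (P b.1), by simpa using hu, fun a b => by simp [hi a.1 b.1 a.2 b.2],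
    fun a => by simp [hc a.1 a.2]⟩

theorem has_ofPred {P : Set Ω → Prop} {hu : P Set.univ}
    {hi : ∀ a b, MeasurableSet a → MeasurableSet b → (P (a ∩ b) ↔ P a ∧ P b)}
    {hc : ∀ a, MeasurableSet a → (P aᶜ ↔ ¬ P a)} :
    (ofPred P hu hi hc).Has b ↔ MeasurableSet b ∧ P b := by
  simp [Has, ofPred]

/-- The point of the Stone space given by a point of the underlying set. -/
noncomputable def principal (x : Ω) : MeasStone Ω :=
  ofPred (fun b => x ∈ b) trivial (fun _ _ _ _ => Iff.rfl) fun _ _ => Iff.rfl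

theorem has_principal {x : Ω} : (principal x).Has b ↔ MeasurableSet b ∧ x ∈ b := has_ofPred

theorem has_inter_iff (ha : MeasurableSet a) (hb : MeasurableSet b) :
    p.Has (a ∩ b) ↔ p.Has a ∧ p.Has b :=
  ⟨fun h => ⟨h.mono Set.inter_subset_left ha, h.mono Set.inter_subset_right hb⟩,
    fun h => h.1.inter h.2⟩

variable {S : Type*}

/-- The limit of a family of points along an ultrafilter. -/
noncomputable def ulim (𝒰 : Ultrafilter S) (d : S → MeasStone Ω) : MeasStone Ω :=
  ofPred (fun b => ∀ᶠ i in 𝒰, (d i).Has b) (Eventually.of_forall fun i => (d i).has_univ)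
    (fun a b ha hb => by
      rw [← eventually_and]
      exact eventually_congr (Eventually.of_forall fun i => has_inter_iff ha hb))
    (fun a ha => by
      rw [← Ultrafilter.eventually_not]
      exact eventually_congr (Eventually.of_forall fun i => has_compl_iff ha))

theorem tendsto_ulim (𝒰 : Ultrafilter S) (d : S → MeasStone Ω) :
    Tendsto d 𝒰 (𝓝 (ulim 𝒰 d)) := by
  intro U hU
  obtain ⟨b, hb, hbU⟩ := exists_has_of_mem_nhds hU
  exact (has_ofPred.1 hb).2.mono fun i hi => hbU _ hi

/-- A family of points lying in pairwise disjoint measurable sets. -/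
def Separated (d : S → MeasStone Ω) : Prop :=
  ∃ b : S → Set Ω, Pairwise (Function.onFun Disjoint b) ∧ ∀ i, (d i).Has (b i)

theorem Separated.injective {d : S → MeasStone Ω} (hd : Separated d) : Function.Injective d := by
  obtain ⟨b, hb, h⟩ := hd
  intro i j hij
  by_contra hne
  exact (h i).not_has_of_disjoint (hb hne) (hij ▸ h j)

theorem Separated.comp {T : Type*} {d : S → MeasStone Ω} (hd : Separated d) {e : T → S}
    (he : Function.Injective e) : Separated (d ∘ e) := by
  obtain ⟨b, hb, h⟩ := hd
  exact ⟨b ∘ e, fun i j hij => hb (he.ne hij), fun i => h (e i)⟩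

/-- Discreteness gives each point a measurable set missing the other points; subtracting the earlier
sets makes them disjoint. -/
theorem separated_of_isEmbedding {d : ℕ → MeasStone Ω} (hd : IsEmbedding d) : Separated d := by
  have h : ∀ n, d n ∉ closure (d '' {n}ᶜ) := fun n hn => by
    have : n ∈ closure ({n}ᶜ : Set ℕ) := by
      rw [hd.closure_eq_preimage_closure_image]
      exact hn
    simp at this
  choose b hb hb' using fun n => exists_has_of_notMem_closure (h n)
  refine ⟨fun n => b n ∩ ⋂ k ∈ Finset.range n, (b k)ᶜ, ?_, fun n => ?_⟩
  · have aux : ∀ m n, m < n → Disjoint (b m ∩ ⋂ k ∈ Finset.range m, (b k)ᶜ)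
        (b n ∩ ⋂ k ∈ Finset.range n, (b k)ᶜ) := fun m n hmn => by
      refine Set.disjoint_left.2 ?_
      rintro z ⟨hz, -⟩ ⟨-, hz'⟩
      simp only [Set.mem_iInter, Finset.mem_range, Set.mem_compl_iff] at hz'
      exact hz' m hmn hz
    intro m n hmn
    rcases lt_or_gt_of_ne hmn with h | h
    · exact aux m n h
    · exact (aux n m h).symm
  · refine (hb n).inter (has_biInter_finset fun k hk => ?_)
    refine (has_compl_iff (hb k).measurableSet).2 (hb' k _ ⟨n, ?_, rfl⟩)
    have := Finset.mem_range.1 hk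
    simp only [Set.mem_compl_iff, Set.mem_singleton_iff]
    omega

end MeasStone

/-! ### Iterated limits along a weak P-point. -/

namespace MeasStone

variable {Ω : Type} [MeasurableSpace Ω] {S : Type}

/-- `Level 𝒰 α p` says that `p` is obtained from principal points by at most `α` steps of taking
`𝒰`-limits of separated families. -/
inductive Level (𝒰 : Ultrafilter S) : Ordinal.{0} → MeasStone Ω → Prop
  | principal (x : Ω) : Level 𝒰 0 (principal x)
  | ulim (d : S → MeasStone Ω) (hd : Separated d) (α : Ordinal.{0}) (β : S → Ordinal.{0})
      (hβ : ∀ i, β i < α) (h : ∀ i, Level 𝒰 (β i) (d i)) : Level 𝒰 α (ulim 𝒰 d)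

/-- Countably many separating sets containing `x` have a measurable intersection. -/
theorem principal_notMem_closure (x : Ω) {C : Set (MeasStone Ω)} (hC : C.Countable)
    (h : ∀ q ∈ C, q ≠ principal x) : principal x ∉ closure C := by
  have := hC.to_subtype
  choose b hb hb' using fun q : C => exists_has_of_ne (h q.1 q.2)
  have hm : MeasurableSet (⋂ q, b q) := MeasurableSet.iInter fun q => (hb q).measurableSet
  refine notMem_closure_of_has (b := ⋂ q, b q)
    (has_principal.2 ⟨hm, Set.mem_iInter.2 fun q => (has_principal.1 (hb q)).2⟩) fun q hq hqb => ?_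
  exact hb' ⟨q, hq⟩ (hqb.mono (Set.iInter_subset b ⟨q, hq⟩) (hb ⟨q, hq⟩).measurableSet)

/-- The limit of a separated family along a weak P-point is outside the closure of a countable set
of other points whose closure misses the family. -/
theorem ulim_notMem_closure [Countable S] {𝒰 : Ultrafilter S} (h𝒰 : IsWeakPPoint 𝒰)
    {d : S → MeasStone Ω} (hd : Separated d) {C : Set (MeasStone Ω)} (hC : C.Countable)
    (hne : ∀ q ∈ C, q ≠ ulim 𝒰 d) (hdC : ∀ i, d i ∉ closure C) : ulim 𝒰 d ∉ closure C := by
  obtain ⟨b, hdisj, hb⟩ := hd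
  -- The part of `C` off the closure of the family is cut off by one measurable set `c`. The rest
  -- consists of limits of `d` along ultrafilters `u q`, which the weak P-point property handles.
  obtain ⟨c, hcm, hc, hcC⟩ := exists_separating_of_countable (P := Set.range d)
    (Q := {q ∈ C | q ∉ closure (Set.range d)}) (Set.countable_range d)
    (hC.mono (Set.sep_subset _ _))
    (by
      rintro _ ⟨i, rfl⟩ h
      exact hdC i (closure_mono (Set.sep_subset _ _) h))
    fun q hq => hq.2
  have hQ : ∀ q : {q ∈ C | q ∈ closure (Set.range d)}, ∃ u : Ultrafilter S,
      Tendsto d u (𝓝 q.1) := by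
    rintro ⟨q, hqC, hq⟩
    have : (comap d (𝓝 q)).NeBot := comap_neBot_iff.2 fun U hU => by
      obtain ⟨_, hU, i, rfl⟩ := mem_closure_iff_nhds.1 hq U hU
      exact ⟨i, hU⟩
    exact ⟨Ultrafilter.of (comap d (𝓝 q)), map_le_iff_le_comap.2 (Ultrafilter.of_le _)⟩
  choose u hu using hQ
  have hcount := (hC.mono (Set.sep_subset C fun q => q ∈ closure (Set.range d))).to_subtype
  obtain ⟨V, hV, hVu⟩ := h𝒰.2 (Set.range u) (Set.countable_range u) (by
    rintro _ ⟨q, rfl⟩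
    refine ⟨?_, fun h => ?_⟩
    -- A principal `u q` would put some `d i` in `C`; `u q = 𝒰` would make `q` the limit itself.
    · rcases (u q).le_cofinite_or_eq_pure with h | ⟨i, hi⟩
      · exact h
      · have h1 := hu q
        rw [hi] at h1
        have h2 : d i = q.1 := tendsto_nhds_unique
          (tendsto_pure_left.2 fun U hU => mem_of_mem_nhds hU) h1
        exact absurd (subset_closure (h2 ▸ q.2.1)) (hdC i)
    · have h1 := hu q
      rw [h] at h1
      exact hne q.1 q.2.1 (tendsto_nhds_unique h1 (tendsto_ulim 𝒰 d)))
  have hbV : MeasurableSet (⋃ i ∈ V, b i) :=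
    MeasurableSet.biUnion V.to_countable fun i _ => (hb i).measurableSet
  have hmem : ∀ i, (d i).Has (⋃ i ∈ V, b i) → i ∈ V := fun i hi => by
    by_contra hiV
    refine (hb i).not_has_of_disjoint (Set.disjoint_iUnion₂_right.2 fun j hj => hdisj ?_) hi
    rintro rfl
    exact hiV hj
  refine notMem_closure_of_has (b := c ∩ ⋃ i ∈ V, b i) (Has.inter ?_ ?_) fun q hq hqb => ?_
  · exact has_ofPred.2 ⟨hcm, Eventually.of_forall fun i => hc _ ⟨i, rfl⟩⟩
  · refine has_ofPred.2 ⟨hbV, ?_⟩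
    filter_upwards [hV] with i hi
    exact (hb i).mono (Set.subset_biUnion_of_mem (u := b) hi) hbV
  · by_cases hqd : q ∈ closure (Set.range d)
    · refine hVu _ ⟨⟨q, hq, hqd⟩, rfl⟩ ?_
      have := hu ⟨q, hq, hqd⟩ ((isClopen_setOf_has (⋃ i ∈ V, b i)).isOpen.mem_nhds
        (hqb.mono Set.inter_subset_right hbV))
      exact mem_of_superset this fun i hi => hmem i hi
    · exact hcC q ⟨hq, hqd⟩ (hqb.mono Set.inter_subset_left hcm)

/-- Induction on the level: each `d i` has a level below `α`, so it is not in `C`, and the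
assumption on `C` passes down to that level. Hence no `d i` is in the closure of `C`, and
`ulim_notMem_closure` applies. -/
theorem Level.notMem_closure [Countable S] {𝒰 : Ultrafilter S} (h𝒰 : IsWeakPPoint 𝒰)
    {α : Ordinal.{0}} {p : MeasStone Ω} (hp : Level 𝒰 α p) {C : Set (MeasStone Ω)}
    (hC : C.Countable) (hne : ∀ q ∈ C, q ≠ p) (hα : ∀ q ∈ C, ∀ β < α, ¬ Level 𝒰 β q) :
    p ∉ closure C := by
  induction hp with
  | principal x => exact principal_notMem_closure x hC hne
  | ulim d hd α β hβ h ih =>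
    refine ulim_notMem_closure h𝒰 hd hC hne fun i => ih i (fun q hq hqd => ?_) fun q hq γ hγ =>
      hα q hq γ (hγ.trans (hβ i))
    exact hα q hq (β i) (hβ i) (hqd ▸ h i)

/-- The points obtained from principal points by iterating `𝒰`-limits of separated families. -/
abbrev LimitSpace (Ω : Type) [MeasurableSpace Ω] (𝒰 : Ultrafilter S) : Type :=
  {p : MeasStone Ω // ∃ α, Level 𝒰 α p}

namespace LimitSpace

variable {𝒰 : Ultrafilter S}

/-- The least level of a point. -/
noncomputable def rank (p : LimitSpace Ω 𝒰) : Ordinal.{0} := sInf {α | Level 𝒰 α p.1}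

theorem level_rank (p : LimitSpace Ω 𝒰) : Level 𝒰 (rank p) p.1 := csInf_mem p.2

/-- The points of `F` other than `p` of rank at least `rank p` do not accumulate at `p`. -/
theorem exists_isClopen [Countable S] (h𝒰 : IsWeakPPoint 𝒰) {F : Set (LimitSpace Ω 𝒰)}
    (hF : F.Countable) (p : LimitSpace Ω 𝒰) : ∃ U : Set (LimitSpace Ω 𝒰), IsClopen U ∧ p ∈ U ∧
      ∀ q ∈ F, q ∈ U → q ≠ p → rank q < rank p := by
  have h := (level_rank p).notMem_closure h𝒰
    (C := Subtype.val '' {q ∈ F | q ≠ p ∧ rank p ≤ rank q})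
    ((hF.mono (Set.sep_subset _ _)).image _)
    (by
      rintro _ ⟨q, hq, rfl⟩ h
      exact hq.2.1 (Subtype.ext h))
    (by
      rintro _ ⟨q, hq, rfl⟩ β hβ h
      exact absurd (csInf_le' (s := {α | Level 𝒰 α q.1}) h) (not_le.2 (hβ.trans_le hq.2.2)))
  obtain ⟨b, hb, hb'⟩ := exists_has_of_notMem_closure h
  refine ⟨{q | q.1.Has b}, (isClopen_setOf_has b).preimage continuous_subtype_val, hb,
    fun q hq hqb hqp => ?_⟩
  by_contra hlt
  exact hb' q.1 ⟨q, ⟨hq, hqp, not_lt.1 hlt⟩, rfl⟩ hqb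

theorem isScatteredSet [Countable S] (h𝒰 : IsWeakPPoint 𝒰) {F : Set (LimitSpace Ω 𝒰)}
    (hF : F.Countable) : IsScatteredSet F := by
  intro T hT hne
  obtain ⟨p, hp, hmin⟩ := (InvImage.wf rank wellFounded_lt).has_min T hne
  obtain ⟨U, hU, hpU, hUr⟩ := exists_isClopen h𝒰 (hF.mono hT) p
  refine ⟨p, hp, U, hU.isOpen, Set.Subset.antisymm ?_ (Set.singleton_subset_iff.2 ⟨hpU, hp⟩)⟩
  rintro q ⟨hqU, hqT⟩
  by_contra hqp
  exact hmin q hqT (hUr q hqT hqU hqp)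

theorem baireSpace_baireOneSpace [Countable S] (h𝒰 : IsWeakPPoint 𝒰) :
    BaireSpace (BaireOneSpace (LimitSpace Ω 𝒰)) :=
  baireSpace_baireOneSpace_of_extend fun _ hF φ =>
    exists_isBaireOne_extension rank hF (fun p _ => exists_isClopen h𝒰 hF p) φ

/-- An infinite set contains an infinite discrete sequence, which is separated. Its `𝒰`-limit is
again in the space, and is an accumulation point because `𝒰` is free and the sequence is injective.
-/
theorem countablyCompactSpace [Countable S] [Infinite S] (h𝒰 : (𝒰 : Filter S) ≤ cofinite) :
    CountablyCompactSpace (LimitSpace Ω 𝒰) := by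
  rw [← isCountablyCompact_univ_iff, isCountablyCompact_iff_infinite_subset_has_accPt]
  intro A _ hA
  have := hA.to_subtype
  obtain ⟨f, hf⟩ := exists_topology_isEmbedding_nat A
  obtain ⟨e⟩ := nonempty_equiv_of_countable (α := S) (β := ℕ)
  have hd := (separated_of_isEmbedding
    (IsEmbedding.subtypeVal.comp (IsEmbedding.subtypeVal.comp hf))).comp e.injective
  set d : S → MeasStone Ω := (Subtype.val ∘ Subtype.val ∘ f) ∘ e with hd_def
  choose β hβ using fun i => (f (e i)).1.2
  -- Successors make the supremum strictly larger than every `β i`.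
  have hlim : Level 𝒰 (⨆ i, Order.succ (β i)) (ulim 𝒰 d) :=
    Level.ulim d hd _ β (fun i => (Order.lt_succ (β i)).trans_le
      (Ordinal.le_iSup (fun i => Order.succ (β i)) i)) hβ
  refine ⟨⟨ulim 𝒰 d, _, hlim⟩, Set.mem_univ _, accPt_iff_nhds.2 fun U hU => ?_⟩
  have hU' : ∀ᶠ i in (𝒰 : Filter S), (f (e i)).1 ∈ U :=
    (tendsto_subtype_rng (f := fun i => (f (e i)).1) (x := ⟨ulim 𝒰 d, _, hlim⟩)).2
      (tendsto_ulim 𝒰 d) hU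
  have hne : ∀ᶠ i in (𝒰 : Filter S), d i ≠ ulim 𝒰 d := by
    refine h𝒰 (Set.Subsingleton.finite fun i hi j hj => hd.injective ?_)
    rw [not_not.1 hi, not_not.1 hj]
  obtain ⟨i, hi, hi'⟩ := (hU'.and hne).exists
  exact ⟨(f (e i)).1, ⟨hi, (f (e i)).2⟩, fun h => hi' (congrArg Subtype.val h)⟩

/-- Every nonempty basic open set contains two distinct principal points, one of which differs from
`p`. -/
theorem perfectSpace (hΩ : ∀ b : Set Ω, MeasurableSet b → ∀ x ∈ b, ∃ y ∈ b, ∃ a : Set Ω,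
    MeasurableSet a ∧ x ∈ a ∧ y ∉ a) : PerfectSpace (LimitSpace Ω 𝒰) := by
  refine ⟨fun p _ => accPt_iff_nhds.2 fun U hU => ?_⟩
  rw [nhds_subtype_eq_comap] at hU
  obtain ⟨W, hW, hWU⟩ := hU
  obtain ⟨b, hb, hbW⟩ := exists_has_of_mem_nhds hW
  obtain ⟨x, hx⟩ : b.Nonempty := Set.nonempty_iff_ne_empty.2 fun h => p.1.not_has_empty (h ▸ hb)
  obtain ⟨y, hy, a, ha, hxa, hya⟩ := hΩ b hb.measurableSet x hx
  have hmem : ∀ z ∈ b, (⟨principal z, 0, Level.principal z⟩ : LimitSpace Ω 𝒰) ∈ U := fun z hz =>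
    hWU (hbW _ (has_principal.2 ⟨hb.measurableSet, hz⟩))
  have hxy : principal x ≠ principal y := fun h => by
    have h1 : (principal x).Has a := has_principal.2 ⟨ha, hxa⟩
    rw [h] at h1
    exact hya (has_principal.1 h1).2
  by_cases hp : principal x = p.1
  · exact ⟨_, ⟨hmem y hy, trivial⟩, fun h => hxy (hp.trans (congrArg Subtype.val h).symm)⟩
  · exact ⟨_, ⟨hmem x hx, trivial⟩, fun h => hp (congrArg Subtype.val h)⟩

end LimitSpace

end MeasStone

/-! ### Measurable sets in uncountable powers, and the example. -/

/-- A measurable set in a product depends on countably many coordinates only. -/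
theorem MeasurableSet.exists_countable_dependsOn {ι : Type*} {α : ι → Type*}
    [∀ i, MeasurableSpace (α i)] {b : Set (∀ i, α i)} (hb : MeasurableSet b) :
    ∃ I : Set ι, I.Countable ∧ ∀ x y : ∀ i, α i, (∀ i ∈ I, x i = y i) → (x ∈ b ↔ y ∈ b) := by
  let m : MeasurableSpace (∀ i, α i) :=
    { MeasurableSet' := fun b => ∃ I : Set ι, I.Countable ∧
        ∀ x y : ∀ i, α i, (∀ i ∈ I, x i = y i) → (x ∈ b ↔ y ∈ b)
      measurableSet_empty := ⟨∅, Set.countable_empty, fun _ _ _ => Iff.rfl⟩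
      measurableSet_compl := fun b ⟨I, hI, h⟩ => ⟨I, hI, fun x y hxy => not_congr (h x y hxy)⟩
      measurableSet_iUnion := fun b hb => by
        choose I hI h using hb
        refine ⟨⋃ n, I n, Set.countable_iUnion hI, fun x y hxy => ?_⟩
        simp only [Set.mem_iUnion]
        exact exists_congr fun n => h n x y fun i hi => hxy i (Set.mem_iUnion.2 ⟨n, hi⟩) }
  have hle : MeasurableSpace.pi ≤ m := iSup_le fun i => by
    rintro _ ⟨s, -, rfl⟩
    refine ⟨{i}, Set.countable_singleton i, fun x y hxy => ?_⟩
    rw [Set.mem_preimage, Set.mem_preimage, hxy i rfl]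
  exact hle b hb

/-- Nonempty measurable sets in an uncountable power of `Bool` contain separated points. -/
theorem exists_mem_separated_of_measurableSet {ι : Type*} [Uncountable ι] {b : Set (ι → Bool)}
    (hb : MeasurableSet b) {x : ι → Bool} (hx : x ∈ b) :
    ∃ y ∈ b, ∃ a : Set (ι → Bool), MeasurableSet a ∧ x ∈ a ∧ y ∉ a := by
  classical
  obtain ⟨I, hI, h⟩ := hb.exists_countable_dependsOn
  obtain ⟨i, hi⟩ : ∃ i, i ∉ I := by
    by_contra! hall
    exact Set.not_countable_univ (Set.eq_univ_of_forall hall ▸ hI)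
  refine ⟨Function.update x i (!x i), (h x _ fun j hj => ?_).1 hx, {z | z i = x i},
    measurableSet_eq_fun (measurable_pi_apply i) measurable_const, rfl, by simp⟩
  rw [Function.update_of_ne]
  rintro rfl
  exact hi hj

theorem mainTheorem7 :
    ∃ (X : Type) (_ : TopologicalSpace X),
      Nonempty X ∧ T35Space X ∧ PerfectSpace X ∧ CountablyCompactSpace X ∧
        (∀ S : Set X, S.Countable → IsScatteredSet S) ∧
        BaireSpace (BaireOneSpace X) := by
  obtain ⟨𝒰, h𝒰⟩ := exists_isWeakPPoint
  -- With countably many coordinates singletons would be measurable and principal points isolated.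
  have : Uncountable (Set ℕ) := by
    rw [← Cardinal.aleph0_lt_mk_iff, Cardinal.mk_set, Cardinal.mk_nat]
    exact Cardinal.cantor _
  refine ⟨MeasStone.LimitSpace (Set ℕ → Bool) 𝒰, inferInstance,
    ⟨⟨MeasStone.principal fun _ => true, 0, .principal _⟩⟩, inferInstance,
    MeasStone.LimitSpace.perfectSpace fun b hb x hx => exists_mem_separated_of_measurableSet hb hx,
    MeasStone.LimitSpace.countablyCompactSpace h𝒰.1,
    fun _ hS => MeasStone.LimitSpace.isScatteredSet h𝒰 hS,
    MeasStone.LimitSpace.baireSpace_baireOneSpace h𝒰⟩
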